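/- Let $d\ge 1$ and $N\ge 1$. A *repulsive cost* is a function $c:(\mathbb R^d)^N\to[0,+\infty]$ of the form \[ c(x_1,\dots,x_N)=\sum_{1\le i<j\le N}\frac{1}{\omega(|x_i-x_j|)}, \] where $\omega:[0,\infty)\to[0,\infty)$ is continuous and strictly increasing with $\omega(0)=0$, and $1/0=+\infty$. Let $\rho$ be a Borel probability measure on $\mathbb R^d$ whose concentration satisfies \[ \sup_{x\in\mathbb R^d}\rho(\{x\})<\frac1N. \] A *symmetric plan* for $\rho$ is a Borel probability measure $P$ on $(\mathbb R^d)^N$ that is invariant under all permutations of the $N$ factors and whose $N$ marginals on $\mathbb R^d$ are all equal to $\rho$. Then: 1. for every repulsive cost $c$, \[ \inf\Big\{\int_{(\mathbb R^d)^N} c\,\mathrm dP \;:\; P \text{ a symmetric plan for } \rho\Big\}<+\infty; \] 2. there exist $\alpha>0$ and a symmetric plan $P$ for $\rho$, depending only on $\rho$ and $N$ and not on the cost, such that the support of $P$ is disjoint from $\{(x_1,\dots,x_N) : \exists\, i\ne j,\ |x_i-x_j|<\alpha\}$, and $\int c\,\mathrm dP<+\infty$ for every repulsive cost $c$. -/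

import Mathlib

open MeasureTheory
open scoped NNReal ENNReal

namespace RepulsiveTransport

/-- The space `ℝ^d` with its Euclidean norm. -/
abbrev Pt (d : ℕ) : Type := EuclideanSpace ℝ (Fin d)

/-- The space `(ℝ^d)^N` of configurations of `N` points of `ℝ^d`. -/
abbrev Config (d N : ℕ) : Type := Fin N → Pt d

/-- `c` is a repulsive cost: `c(x₁,…,x_N) = ∑_{i<j} 1 / ω(|x_i - x_j|)` for some continuous,
strictly increasing `ω : [0,∞) → [0,∞)` with `ω 0 = 0`. The cost takes values in `[0,∞]`, and a
term is `∞` exactly where `x_i = x_j`. Differentiability of `ω` on `(0,∞)` is not required. -/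
def IsRepulsiveCost {d N : ℕ} (c : Config d N → ℝ≥0∞) : Prop :=
  ∃ ω : ℝ≥0 → ℝ≥0, Continuous ω ∧ StrictMono ω ∧ ω 0 = 0 ∧
    ∀ x : Config d N, c x =
      ∑ p : Fin N × Fin N with p.1 < p.2, 1 / (ω ‖x p.1 - x p.2‖₊ : ℝ≥0∞)

/-- The concentration `sup_x ρ({x})` of a measure on `ℝ^d`. -/
noncomputable def concentration {d : ℕ} (ρ : Measure (Pt d)) : ℝ≥0∞ :=
  ⨆ x : Pt d, ρ {x}

/-- `P` is a symmetric `N`-transport plan with all marginals equal to `ρ`: a probability measure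
on `(ℝ^d)^N` that is invariant under every permutation of the `N` points and whose projection on
each factor is `ρ`. -/
structure IsSymmetricPlan {d N : ℕ} (ρ : Measure (Pt d)) (P : Measure (Config d N)) : Prop where
  isProbabilityMeasure : IsProbabilityMeasure P
  symmetric : ∀ s : Equiv.Perm (Fin N), P.map (fun x : Config d N => fun i => x (s i)) = P
  marginal : ∀ i : Fin N, P.map (fun x : Config d N => x i) = ρ

/-- The infimum of `∫ c dP` over all symmetric transport plans `P` with marginals `ρ`
(it is `∞` if there is no such plan of finite cost). -/
noncomputable def symmetricTransportCost {d N : ℕ} (c : Config d N → ℝ≥0∞)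
    (ρ : Measure (Pt d)) : ℝ≥0∞ :=
  ⨅ (P : Measure (Config d N)) (_ : IsSymmetricPlan ρ P), ∫⁻ x, c x ∂P

/-- The set of configurations in which two of the points are at distance less than `α`. -/
def nearDiagonal (d N : ℕ) (α : ℝ) : Set (Config d N) :=
  {x | ∃ i j : Fin N, i ≠ j ∧ ‖x i - x j‖ < α}

end RepulsiveTransport

/-!
Split the space into finitely many cells so fine that, for some `α > 0`, the cells within distance
`α` of any given cell have total `ρ`-mass less than `1 / N`; embedding the space uniformly
continuously into the compact Hilbert cube reduces this to Lebesgue numbers. The cell masses of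
`N • ρ` form a weight of total mass `N`, and this weight is a convex combination of the occupation
vectors of `N`-tuples of cells pairwise at least `α` apart: otherwise, by
Hahn–Banach, a linear functional `f` separates them, yet the tuple chosen greedily (take the cell
maximising `f`, then remove one unit of mass including everything near that cell, and repeat) has
`f`-value at least that of the weight.
The corresponding mixture of products of the conditional measures of `ρ` on the cells is a
probability measure whose marginals sum to `N • ρ` and whose points stay `α` apart. Averaging it
over permutations gives the plan.
-/

namespace RepulsiveTransport

section SeparatedTuples

variable {ι : Type*} {n : ℕ}

/-- The `n`-tuples of indices that are pairwise unrelated by `near` and avoid the zeros of the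
weight `u`. -/
def separatedTuples (near : ι → ι → Prop) (u : ι → ℝ) (n : ℕ) : Set (Fin n → ι) :=
  {s | (∀ k, u (s k) ≠ 0) ∧ Pairwise fun i j => ¬near (s i) (s j)}

theorem cons_mem_separatedTuples {near : ι → ι → Prop} [Std.Symm near] {u v : ι → ℝ}
    (hv : ∀ c, v c ≠ 0 → u c ≠ 0) {a : ι} (ha : u a ≠ 0) (hva : ∀ c, near a c → v c = 0)
    {s : Fin n → ι} (hs : s ∈ separatedTuples near v n) :
    (Fin.cons a s : Fin (n + 1) → ι) ∈ separatedTuples near u (n + 1) := by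
  have hsa (k : Fin n) : ¬near a (s k) := fun h => hs.1 k (hva _ h)
  refine ⟨Fin.cases ha fun k => hv _ (hs.1 k), fun i j => ?_⟩
  cases i using Fin.cases <;> cases j using Fin.cases
  · exact fun h => absurd rfl h
  · exact fun _ => hsa _
  · exact fun _ h => hsa _ (Std.Symm.symm _ _ h)
  · exact fun hij => hs.2 (mt (congrArg Fin.succ) hij)

/-- The occupation vector of a tuple: its `c`-th entry counts how often the tuple takes the
value `c`. It is real-valued so that convex combinations of occupation vectors make sense. -/
def occupation [DecidableEq ι] (s : Fin n → ι) : ι → ℝ := fun c => ({k | s k = c} : Finset _).card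

variable [Fintype ι]

theorem exists_le_sum_eq_of_le_sum (A : Finset ι) {u : ι → ℝ} (hu : 0 ≤ u) {t : ℝ}
    (ht : 0 ≤ t) (htA : t ≤ ∑ c ∈ A, u c) :
    ∃ v : ι → ℝ, 0 ≤ v ∧ v ≤ u ∧ (∀ c ∉ A, v c = 0) ∧ ∑ c, v c = t := by
  classical
  set m := ∑ c ∈ A, u c
  have hscale : 0 ≤ t / m := div_nonneg ht (ht.trans htA)
  refine ⟨fun c => if c ∈ A then t / m * u c else 0, fun c => ?_, fun c => ?_, fun c hc => ?_, ?_⟩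
  · exact ite_nonneg (mul_nonneg hscale (hu c)) le_rfl
  · dsimp only
    split_ifs
    · exact mul_le_of_le_one_left (hu c) (div_le_one_of_le₀ htA (ht.trans htA))
    · exact hu c
  · exact if_neg hc
  · rw [Finset.sum_ite_mem, Finset.univ_inter, ← Finset.mul_sum]
    exact div_mul_cancel_of_imp fun hm => le_antisymm (htA.trans_eq hm) ht

theorem sum_mul_le_sum_mul_add_of_le {f u v : ι → ℝ} {b : ℝ} (hv : 0 ≤ v) (hvu : v ≤ u)
    (hf : ∀ c, u c ≠ 0 → f c ≤ b) :
    ∑ c, u c * f c ≤ ∑ c, v c * f c + (∑ c, u c - ∑ c, v c) * b := by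
  rw [← Finset.sum_sub_distrib, Finset.sum_mul, ← Finset.sum_add_distrib]
  refine Finset.sum_le_sum fun c _ => ?_
  by_cases hc : u c = 0
  · have hvc : v c = 0 := le_antisymm (hc ▸ hvu c) (hv c)
    simp [hc, hvc]
  · linarith [mul_le_mul_of_nonneg_left (hf c hc) (sub_nonneg.2 (hvu c))]

theorem exists_mem_separatedTuples_sum_mul_le {near : ι → ι → Prop} [DecidableRel near]
    [Std.Symm near] (f : ι → ℝ) {u : ι → ℝ} (hu : 0 ≤ u) (hsum : ∑ c, u c = n)
    (hnear : ∀ a, u a ≠ 0 → ∑ c with near a c, u c < 1) :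
    ∃ s ∈ separatedTuples near u n, ∑ c, u c * f c ≤ ∑ k, f (s k) := by
  induction n generalizing u with
  | zero =>
    have hzero : u = 0 := (Fintype.sum_eq_zero_iff_of_nonneg hu).1 (by simpa using hsum)
    exact ⟨Fin.elim0, ⟨fun k => k.elim0, fun i => i.elim0⟩, by simp [hzero]⟩
  | succ n ih =>
    have hne : ({c | u c ≠ 0} : Finset ι).Nonempty := by
      obtain ⟨c, -, hc⟩ := Finset.exists_ne_zero_of_sum_ne_zero
        (hsum.trans_ne (Nat.cast_ne_zero.2 n.succ_ne_zero))
      exact ⟨c, by simpa using hc⟩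
    obtain ⟨a, ha, hmax⟩ := Finset.exists_max_image _ f hne
    replace ha : u a ≠ 0 := by simpa using ha
    replace hmax : ∀ c, u c ≠ 0 → f c ≤ f a := fun c hc => hmax c (by simpa using hc)
    have hfar : (n : ℝ) ≤ ∑ c with ¬near a c, u c := by
      have hsplit := Finset.sum_filter_add_sum_filter_not Finset.univ (near a) u
      push_cast at hsum
      linarith [hnear a ha]
    obtain ⟨v, hv, hvu, hva, hvsum⟩ := exists_le_sum_eq_of_le_sum _ hu n.cast_nonneg hfar
    have hvsupp (c : ι) (hc : v c ≠ 0) : u c ≠ 0 := fun h => hc (le_antisymm (h ▸ hvu c) (hv c))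
    obtain ⟨s, hs, hle⟩ := ih hv hvsum fun c hc =>
      (Finset.sum_le_sum fun c' _ => hvu c').trans_lt (hnear c (hvsupp c hc))
    refine ⟨Fin.cons a s,
      cons_mem_separatedTuples hvsupp ha (fun c hc => hva c (by simpa using hc)) hs, ?_⟩
    calc ∑ c, u c * f c ≤ ∑ c, v c * f c + (∑ c, u c - ∑ c, v c) * f a :=
          sum_mul_le_sum_mul_add_of_le hv hvu hmax
      _ = ∑ c, v c * f c + f a := by
          rw [hsum, hvsum]
          push_cast
          ring
      _ ≤ f a + ∑ k, f (s k) := by linarith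
      _ = ∑ k, f ((Fin.cons a s : Fin (n + 1) → ι) k) := by simp [Fin.sum_univ_succ]

theorem sum_card_fiber_smul [DecidableEq ι] {M : Type*} [AddCommMonoid M] (s : Fin n → ι)
    (m : ι → M) : ∑ c, ({k | s k = c} : Finset _).card • m c = ∑ k, m (s k) := by
  simp_rw [← Finset.sum_const]
  exact Finset.sum_fiberwise' _ s m

theorem mem_convexHull_occupation [DecidableEq ι] {near : ι → ι → Prop} [DecidableRel near]
    [Std.Symm near] {u : ι → ℝ} (hu : 0 ≤ u) (hsum : ∑ c, u c = n)
    (hnear : ∀ a, u a ≠ 0 → ∑ c with near a c, u c < 1) :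
    u ∈ convexHull ℝ (occupation '' separatedTuples near u n) := by
  by_contra hnot
  obtain ⟨L, t, hlt, hgt⟩ := geometric_hahn_banach_closed_point
    (convex_convexHull ℝ (occupation '' separatedTuples near u n))
    ((Set.toFinite _).isClosed_convexHull ℝ) hnot
  let f : ι → ℝ := fun c => L (Pi.single c 1)
  have hL (x : ι → ℝ) : L x = ∑ c, x c * f c := by
    conv_lhs => rw [pi_eq_sum_univ' x, map_sum]
    simp only [map_smul, smul_eq_mul, f]
  obtain ⟨s, hs, hle⟩ := exists_mem_separatedTuples_sum_mul_le f hu hsum hnear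
  have hLs : L (occupation s) = ∑ k, f (s k) := by
    simp only [hL, occupation, ← nsmul_eq_mul, sum_card_fiber_smul]
  have := hlt _ (subset_convexHull ℝ _ ⟨s, hs, rfl⟩)
  linarith [hL u]

end SeparatedTuples

section Mixtures

variable {X ι : Type*} [MeasurableSpace X] {n : ℕ}

theorem exists_measure_of_mem_convexHull_occupation [Fintype ι] [DecidableEq ι]
    {T : Set (Fin n → ι)} {u : ι → ℝ} (hu : u ∈ convexHull ℝ (occupation '' T)) {m : ι → Measure X}
    (hm : ∀ s ∈ T, ∀ k, IsProbabilityMeasure (m (s k))) {g : X → ι}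
    (hg : ∀ c, ∀ᵐ x ∂m c, g x = c) :
    ∃ Q : Measure (Fin n → X), IsProbabilityMeasure Q ∧ (∀ᵐ x ∂Q, g ∘ x ∈ T) ∧
      ∑ k, Q.map (fun x => x k) = ∑ c, ENNReal.ofReal (u c) • m c := by
  obtain ⟨κ, _, p, z, hp, hpsum, hz, rfl⟩ := mem_convexHull_iff_exists_fintype.1 hu
  choose s hs hsz using hz
  have hprob (a : κ) (k : Fin n) : IsProbabilityMeasure (m (s a k)) := hm _ (hs a) k
  let Q : Measure (Fin n → X) := ∑ a, ENNReal.ofReal (p a) • Measure.pi fun k => m (s a k)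
  have hmarg (k : Fin n) : Q.map (fun x => x k) = ∑ a, ENNReal.ofReal (p a) • m (s a k) := by
    simp only [Q]
    rw [Measure.map_finset_sum' (measurable_pi_apply k).aemeasurable]
    simp only [Measure.map_smul]
    exact Finset.sum_congr rfl fun a _ =>
      congrArg _ (measurePreserving_eval (fun k => m (s a k)) k).map_eq
  refine ⟨Q, ⟨?_⟩, ?_, ?_⟩
  · simp only [Q, Measure.finsetSum_apply, Measure.smul_apply, measure_univ, smul_eq_mul, mul_one]
    rw [← ENNReal.ofReal_sum_of_nonneg fun a _ => hp a, hpsum, ENNReal.ofReal_one]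
  · rw [show Q = Measure.sum _ from (Measure.sum_fintype _).symm, Measure.ae_sum_iff]
    refine fun a => Measure.ae_smul_measure ?_ _
    have hcell (k : Fin n) : ∀ᵐ x ∂Measure.pi fun k => m (s a k), g (x k) = s a k :=
      (Measure.quasiMeasurePreserving_eval (fun k => m (s a k)) k).ae (hg (s a k))
    filter_upwards [ae_all_iff.2 hcell] with x hx
    rw [show g ∘ x = s a from funext hx]
    exact hs a
  · have hcoeff (c : ι) : ENNReal.ofReal ((∑ a, p a • z a) c) =
        ∑ a, ENNReal.ofReal (p a) * ({k | s a k = c} : Finset _).card := by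
      simp only [Finset.sum_apply, Pi.smul_apply, smul_eq_mul, ← hsz, occupation]
      rw [ENNReal.ofReal_sum_of_nonneg fun a _ => mul_nonneg (hp a) (Nat.cast_nonneg _)]
      simp only [ENNReal.ofReal_mul (hp _), ENNReal.ofReal_natCast]
    calc ∑ k, Q.map (fun x => x k)
        = ∑ a, ENNReal.ofReal (p a) • ∑ k, m (s a k) := by
          simp only [hmarg, Finset.smul_sum]
          exact Finset.sum_comm
      _ = ∑ a, ∑ c, (ENNReal.ofReal (p a) * ({k | s a k = c} : Finset _).card) • m c := by
          simp only [← sum_card_fiber_smul, Finset.smul_sum, mul_smul, Nat.cast_smul_eq_nsmul]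
      _ = ∑ c, ENNReal.ofReal ((∑ a, p a • z a) c) • m c := by
          simp only [hcoeff, Finset.sum_smul]
          exact Finset.sum_comm

open ProbabilityTheory in
theorem exists_measure_pairwise_not_near [Finite ι] [MeasurableSpace ι]
    [MeasurableSingletonClass ι] {μ : Measure X} [IsFiniteMeasure μ] (hμ : μ Set.univ = n)
    {g : X → ι} (hg : Measurable g) {near : ι → ι → Prop} [Std.Symm near]
    (hnear : ∀ x, μ {z | near (g x) (g z)} < 1) :
    ∃ Q : Measure (Fin n → X), IsProbabilityMeasure Q ∧
      (∀ᵐ x ∂Q, Pairwise fun i j => ¬near (g (x i)) (g (x j))) ∧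
      ∑ k, Q.map (fun x => x k) = μ := by
  classical
  cases nonempty_fintype ι
  let u : ι → ℝ := fun c => μ.real (g ⁻¹' {c})
  have hcell (c : ι) : MeasurableSet (g ⁻¹' {c}) := hg (measurableSet_singleton c)
  have hsum (A : Finset ι) : ∑ c ∈ A, u c = μ.real (g ⁻¹' A) :=
    sum_measureReal_preimage_singleton A fun c _ => hcell c
  have hsum_near (a : ι) (ha : u a ≠ 0) : ∑ c with near a c, u c < 1 := by
    obtain ⟨x, rfl⟩ : (g ⁻¹' {a}).Nonempty := nonempty_of_measureReal_ne_zero ha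
    rw [hsum, measureReal_def, ← ENNReal.toReal_one]
    exact ENNReal.toReal_strict_mono ENNReal.one_ne_top (by simpa using hnear x)
  have hconv := mem_convexHull_occupation (n := n) (fun c => measureReal_nonneg)
    (by rw [hsum]; simp [measureReal_def, hμ]) hsum_near
  obtain ⟨Q, hQ, hsep, hmarg⟩ := exists_measure_of_mem_convexHull_occupation
    (m := fun c => μ[|g ← c]) hconv
    (fun s hs k => cond_isProbabilityMeasure fun h => hs.1 k (by simp [measureReal_def, h]))
    (fun c => ae_cond_mem (hcell c))
  refine ⟨Q, hQ, hsep.mono fun x hx => hx.2, hmarg.trans ?_⟩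
  simpa only [u, ofReal_measureReal (measure_ne_top μ _)] using sum_meas_smul_cond_fiber hg μ

end Mixtures

section Partitions

open Metric

theorem exists_forall_measure_ball_lt {Y : Type*} [PseudoMetricSpace Y] [CompactSpace Y]
    [MeasurableSpace Y] {μ : Measure Y} [μ.OuterRegular] {ε : ℝ≥0∞} (h : ∀ y, μ {y} < ε) :
    ∃ r > 0, ∀ y, μ (ball y r) < ε := by
  choose U hyU hU hμU using fun y => Set.exists_isOpen_lt_of_lt {y} ε (h y)
  obtain ⟨r, hr, hball⟩ := lebesgue_number_lemma_of_metric isCompact_univ hU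
    fun y _ => Set.mem_iUnion_of_mem y (hyU y rfl)
  refine ⟨r, hr, fun y => ?_⟩
  obtain ⟨z, hz⟩ := hball y (Set.mem_univ y)
  exact (measure_mono hz).trans_lt (hμU z)

theorem exists_measurable_fin_dist_lt {Y : Type*} [PseudoMetricSpace Y] [CompactSpace Y]
    [MeasurableSpace Y] [OpensMeasurableSpace Y] {r : ℝ} (hr : 0 < r) :
    ∃ (n : ℕ) (g : Y → Fin n), Measurable g ∧ ∀ x y, g x = g y → dist x y < r := by
  obtain ⟨t, -, ht, hcover⟩ := finite_cover_balls_of_compact (isCompact_univ (X := Y)) (half_pos hr)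
  have := ht.to_subtype
  -- The fibres of `g` are the atoms of the finite algebra generated by the covering balls.
  let g : Y → (t → Prop) := fun y c => y ∈ ball (c : Y) (r / 2)
  have hg : Measurable g := measurable_pi_lambda _ fun c => measurableSet_ball.mem
  refine ⟨_, Finite.equivFin _ ∘ g, Measurable.of_discrete.comp hg, fun x y hxy => ?_⟩
  obtain ⟨c, hct, hxc⟩ := Set.mem_iUnion₂.1 (hcover (Set.mem_univ x))
  have hyc : y ∈ ball c (r / 2) :=
    (congrFun ((Finite.equivFin _).injective hxy) ⟨c, hct⟩).mp hxc
  linarith [dist_triangle_right x y c, mem_ball.1 hxc, mem_ball.1 hyc]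

/-- Two cells `g ⁻¹' {a}`, `g ⁻¹' {b}` of the partition of `X` into the fibres of `g` come within
distance `α` of each other. -/
def CellsWithin {X ι : Type*} [PseudoMetricSpace X] (g : X → ι) (α : ℝ) (a b : ι) : Prop :=
  ∃ x y, g x = a ∧ g y = b ∧ dist x y < α

instance CellsWithin.instSymm {X ι : Type*} [PseudoMetricSpace X] (g : X → ι) (α : ℝ) :
    Std.Symm (CellsWithin g α) :=
  ⟨fun _ _ ⟨x, y, hx, hy, hxy⟩ => ⟨y, x, hy, hx, by rwa [dist_comm]⟩⟩

theorem le_dist_of_not_cellsWithin {X ι : Type*} [PseudoMetricSpace X] {g : X → ι} {α : ℝ}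
    {x y : X} (h : ¬CellsWithin g α (g x) (g y)) : α ≤ dist x y :=
  not_lt.1 fun hxy => h ⟨x, y, rfl, rfl, hxy⟩

theorem exists_partition_measure_cellsWithin_lt_of_compactSpace {Y : Type*} [PseudoMetricSpace Y]
    [CompactSpace Y] [MeasurableSpace Y] [OpensMeasurableSpace Y] {μ : Measure Y}
    [μ.OuterRegular] {ε : ℝ≥0∞} (h : ∀ y, μ {y} < ε) :
    ∃ (α : ℝ) (n : ℕ) (g : Y → Fin n), 0 < α ∧ Measurable g ∧
      ∀ y, μ {z | CellsWithin g α (g y) (g z)} < ε := by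
  obtain ⟨r, hr, hball⟩ := exists_forall_measure_ball_lt h
  obtain ⟨n, g, hg, hcell⟩ := exists_measurable_fin_dist_lt (Y := Y) (r := r / 3) (by positivity)
  refine ⟨r / 3, n, g, by positivity, hg, fun y => (measure_mono ?_).trans_lt (hball y)⟩
  rintro z ⟨a, b, ha, hb, hab⟩
  rw [mem_ball]
  linarith [dist_triangle4 z b a y, hcell z b hb.symm, hcell a y ha, dist_comm a b]

theorem exists_partition_measure_cellsWithin_lt_of_uniformContinuous {X Y : Type*}
    [PseudoMetricSpace X] [MeasurableSpace X] [OpensMeasurableSpace X] [MetricSpace Y]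
    [CompactSpace Y] [MeasurableSpace Y] [BorelSpace Y] {μ : Measure X} [IsFiniteMeasure μ]
    {ε : ℝ≥0∞} (h : ∀ x, μ {x} < ε) (hε : 0 < ε) {e : X → Y} (he : UniformContinuous e)
    (hinj : e.Injective) :
    ∃ (α : ℝ) (n : ℕ) (g : X → Fin n), 0 < α ∧ Measurable g ∧
      ∀ x, μ {z | CellsWithin g α (g x) (g z)} < ε := by
  have he_meas : Measurable e := he.continuous.measurable
  have hatom (y : Y) : μ.map e {y} < ε := by
    rw [Measure.map_apply he_meas (measurableSet_singleton y)]
    obtain h' | ⟨x, hx⟩ := (Set.subsingleton_singleton.preimage hinj).eq_empty_or_singleton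
    · rwa [h', measure_empty]
    · rw [hx]
      exact h x
  obtain ⟨α, n, g, hα, hg, hcell⟩ := exists_partition_measure_cellsWithin_lt_of_compactSpace hatom
  obtain ⟨β, hβ, hdist⟩ := Metric.uniformContinuous_iff.1 he α hα
  refine ⟨β, n, g ∘ e, hβ, hg.comp he_meas, fun x => ?_⟩
  calc μ {z | CellsWithin (g ∘ e) β (g (e x)) (g (e z))}
      ≤ μ (e ⁻¹' {z | CellsWithin g α (g (e x)) (g z)}) := by
        refine measure_mono ?_
        rintro z ⟨a, b, ha, hb, hab⟩
        exact ⟨e a, e b, ha, hb, hdist hab⟩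
    _ ≤ μ.map e {z | CellsWithin g α (g (e x)) (g z)} := Measure.le_map_apply he_meas.aemeasurable _
    _ < ε := hcell (e x)

open Metric.PiNatEmbed in
theorem uniformContinuous_distDenseSeq (X : Type*) [MetricSpace X]
    [TopologicalSpace.SeparableSpace X] :
    UniformContinuous fun (x : X) n => distDenseSeq X n x := by
  refine uniformContinuous_pi.2 fun n => ?_
  cases isEmpty_or_nonempty X
  · exact Metric.uniformContinuous_iff.2 fun ε _ => ⟨1, one_pos, fun x => isEmptyElim x⟩
  · have hdist : UniformContinuous fun x : X => dist x (TopologicalSpace.denseSeq X n) :=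
      (LipschitzWith.dist_left _).uniformContinuous
    exact (LipschitzWith.projIcc zero_le_one).uniformContinuous.comp hdist

open Metric.PiNatEmbed in
theorem exists_partition_measure_cellsWithin_lt {X : Type*} [MetricSpace X]
    [TopologicalSpace.SeparableSpace X] [MeasurableSpace X] [OpensMeasurableSpace X]
    {μ : Measure X} [IsFiniteMeasure μ] {ε : ℝ≥0∞} (h : ∀ x, μ {x} < ε) (hε : 0 < ε) :
    ∃ (α : ℝ) (n : ℕ) (g : X → Fin n), 0 < α ∧ Measurable g ∧
      ∀ x, μ {z | CellsWithin g α (g x) (g z)} < ε := by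
  let : MetricSpace (ℕ → unitInterval) := PiCountable.metricSpace
  refine exists_partition_measure_cellsWithin_lt_of_uniformContinuous h hε
    (uniformContinuous_distDenseSeq X) fun x y hxy => by_contra fun hne => ?_
  obtain ⟨n, hn⟩ := injective_distDenseSeq x y hne
  exact hn (congrFun hxy n)

end Partitions

section Symmetrization

variable {X I : Type*} [MeasurableSpace X]

theorem measurable_reindex (σ : Equiv.Perm I) : Measurable fun (x : I → X) i => x (σ i) :=
  measurable_pi_lambda _ fun i => measurable_pi_apply (σ i)

theorem map_eval_eq_of_map_reindex_eq {P : Measure (I → X)}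
    (h : ∀ σ : Equiv.Perm I, P.map (fun x i => x (σ i)) = P) (i j : I) :
    P.map (fun x => x i) = P.map (fun x => x j) := by
  classical
  conv_rhs => rw [← h (Equiv.swap i j)]
  rw [Measure.map_map (measurable_pi_apply j) (measurable_reindex _)]
  simp only [Function.comp_def, Equiv.swap_apply_right]

theorem inv_card_smul_card_nsmul {M : Type*} [AddCommMonoid M] [Module ℝ≥0∞ M] (κ : Type*)
    [Fintype κ] [Nonempty κ] (m : M) :
    (Fintype.card κ : ℝ≥0∞)⁻¹ • Fintype.card κ • m = m := by
  rw [← Nat.cast_smul_eq_nsmul ℝ≥0∞, smul_smul,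
    ENNReal.inv_mul_cancel (Nat.cast_ne_zero.2 Fintype.card_ne_zero) (ENNReal.natCast_ne_top _),
    one_smul]

theorem map_eval_eq_of_sum_map_eval_eq [Fintype I] {P : Measure (I → X)}
    (h : ∀ σ : Equiv.Perm I, P.map (fun x i => x (σ i)) = P) {ρ : Measure X}
    (hsum : ∑ i, P.map (fun x => x i) = Fintype.card I • ρ) (i : I) :
    P.map (fun x => x i) = ρ := by
  have : Nonempty I := ⟨i⟩
  have hcard : ∑ j, P.map (fun x => x j) = Fintype.card I • P.map (fun x => x i) :=
    Finset.sum_eq_card_nsmul fun j _ => map_eval_eq_of_map_reindex_eq h j i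
  rw [← inv_card_smul_card_nsmul I (P.map fun x => x i), ← hcard, hsum, inv_card_smul_card_nsmul]

variable [Fintype I] [DecidableEq I]

/-- The average of the images of `Q` under all permutations of the coordinates. -/
noncomputable def symmetrization (Q : Measure (I → X)) : Measure (I → X) :=
  (Fintype.card (Equiv.Perm I) : ℝ≥0∞)⁻¹ • ∑ σ : Equiv.Perm I, Q.map fun x i => x (σ i)

instance symmetrization.instIsProbabilityMeasure (Q : Measure (I → X)) [IsProbabilityMeasure Q] :
    IsProbabilityMeasure (symmetrization Q) where
  measure_univ := by
    have hmap (σ : Equiv.Perm I) : Q.map (fun x i => x (σ i)) Set.univ = 1 := by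
      rw [Measure.map_apply (measurable_reindex σ) .univ, Set.preimage_univ, measure_univ]
    simp only [symmetrization, Measure.smul_apply, Measure.finsetSum_apply, hmap,
      Finset.sum_const, Finset.card_univ, inv_card_smul_card_nsmul]

theorem map_reindex_symmetrization (Q : Measure (I → X)) (τ : Equiv.Perm I) :
    (symmetrization Q).map (fun x i => x (τ i)) = symmetrization Q := by
  simp only [symmetrization, Measure.map_smul]
  rw [Measure.map_finset_sum' (measurable_reindex τ).aemeasurable]
  simp only [Measure.map_map (measurable_reindex τ) (measurable_reindex _)]
  congr 1
  exact Fintype.sum_equiv (Equiv.mulRight τ) _ _ fun σ => rfl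

theorem ae_symmetrization {Q : Measure (I → X)} {p : (I → X) → Prop}
    (hp : MeasurableSet {x | p x}) (hperm : ∀ (σ : Equiv.Perm I) x, p x → p fun i => x (σ i))
    (h : ∀ᵐ x ∂Q, p x) : ∀ᵐ x ∂symmetrization Q, p x := by
  refine Measure.ae_smul_measure ?_ _
  rw [← Measure.sum_fintype, Measure.ae_sum_iff]
  exact fun σ => (ae_map_iff (measurable_reindex σ).aemeasurable hp).2 (h.mono (hperm σ))

theorem sum_map_eval_symmetrization (Q : Measure (I → X)) :
    ∑ i, (symmetrization Q).map (fun x => x i) = ∑ i, Q.map (fun x => x i) := by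
  have hmarg (i : I) : (symmetrization Q).map (fun x => x i) =
      (Fintype.card (Equiv.Perm I) : ℝ≥0∞)⁻¹ • ∑ σ : Equiv.Perm I, Q.map (fun x => x (σ i)) := by
    simp only [symmetrization, Measure.map_smul]
    rw [Measure.map_finset_sum' (measurable_pi_apply i).aemeasurable]
    simp only [Measure.map_map (measurable_pi_apply i) (measurable_reindex _)]
    rfl
  simp only [hmarg]
  rw [← Finset.smul_sum, Finset.sum_comm]
  simp only [fun σ : Equiv.Perm I => Equiv.sum_comp σ fun i => Q.map fun x => x i,
    Finset.sum_const, Finset.card_univ, inv_card_smul_card_nsmul]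

end Symmetrization

section SeparatedPlans

theorem isClosed_setOf_pairwise_le_dist {X I : Type*} [PseudoMetricSpace X] (α : ℝ) :
    IsClosed {x : I → X | Pairwise fun i j => α ≤ dist (x i) (x j)} := by
  simp only [Pairwise, Set.ofPred_forall]
  exact isClosed_iInter fun i => isClosed_iInter fun j => isClosed_iInter fun _ =>
    isClosed_le continuous_const ((continuous_apply i).dist (continuous_apply j))

theorem lintegral_sum_one_div_lt_top {X : Type*} [PseudoMetricSpace X] [MeasurableSpace X] {n : ℕ}
    {P : Measure (Fin n → X)} [IsFiniteMeasure P] {α : ℝ} (hα : 0 < α)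
    (hP : ∀ᵐ x ∂P, Pairwise fun i j => α ≤ dist (x i) (x j)) {ω : ℝ≥0 → ℝ≥0} (hmono : Monotone ω)
    (hpos : ∀ r, 0 < r → 0 < ω r) :
    ∫⁻ x, ∑ p : Fin n × Fin n with p.1 < p.2, 1 / (ω (nndist (x p.1) (x p.2)) : ℝ≥0∞) ∂P < ⊤ := by
  let C : ℝ≥0∞ := ∑ p : Fin n × Fin n with p.1 < p.2, 1 / (ω α.toNNReal : ℝ≥0∞)
  have hC : C < ⊤ := ENNReal.sum_lt_top.2 fun _ _ => ENNReal.div_lt_top ENNReal.one_ne_top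
    (ENNReal.coe_ne_zero.2 (hpos _ (Real.toNNReal_pos.2 hα)).ne')
  refine (lintegral_mono_ae (hP.mono fun x hx => ?_)).trans_lt (lintegral_const_lt_top hC.ne)
  refine Finset.sum_le_sum fun p hp => ENNReal.div_le_div_left (ENNReal.coe_le_coe.2 ?_) _
  exact hmono (Real.toNNReal_le_iff_le_coe.2 (hx (Finset.mem_filter.1 hp).2.ne))

theorem exists_measure_pairwise_le_dist {X : Type*} [MetricSpace X]
    [TopologicalSpace.SeparableSpace X] [MeasurableSpace X] [OpensMeasurableSpace X] {n : ℕ}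
    {μ : Measure X} [IsFiniteMeasure μ] (hμ : μ Set.univ = n) (hatom : ∀ x, μ {x} < 1) :
    ∃ α : ℝ, 0 < α ∧ ∃ Q : Measure (Fin n → X), IsProbabilityMeasure Q ∧
      (∀ᵐ x ∂Q, Pairwise fun i j => α ≤ dist (x i) (x j)) ∧ ∑ i, Q.map (fun x => x i) = μ := by
  obtain ⟨α, _, g, hα, hg, hcell⟩ := exists_partition_measure_cellsWithin_lt hatom one_pos
  obtain ⟨Q, hQ, hsep, hsum⟩ := exists_measure_pairwise_not_near hμ hg hcell
  exact ⟨α, hα, Q, hQ, hsep.mono fun x hx i j hij => le_dist_of_not_cellsWithin (hx hij), hsum⟩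

end SeparatedPlans

theorem compl_nearDiagonal {d N : ℕ} {α : ℝ} :
    (nearDiagonal d N α)ᶜ = {x | Pairwise fun i j => α ≤ dist (x i) (x j)} := by
  ext x
  simp [nearDiagonal, Pairwise, dist_eq_norm]

theorem IsRepulsiveCost.exists_monotone {d N : ℕ} {c : Config d N → ℝ≥0∞}
    (hc : IsRepulsiveCost c) : ∃ ω : ℝ≥0 → ℝ≥0, Monotone ω ∧ (∀ r, 0 < r → 0 < ω r) ∧
      c = fun x => ∑ p : Fin N × Fin N with p.1 < p.2,
        1 / (ω (nndist (x p.1) (x p.2)) : ℝ≥0∞) := by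
  obtain ⟨ω, -, hmono, hω, hcω⟩ := hc
  exact ⟨ω, hmono.monotone, fun r hr => hω ▸ hmono hr,
    funext fun x => by simp only [hcω, nndist_eq_nnnorm]⟩

end RepulsiveTransport

open RepulsiveTransport in
theorem theorem1p3_general {X : Type*} [MetricSpace X] [TopologicalSpace.SeparableSpace X]
    [MeasurableSpace X] [BorelSpace X] (N : ℕ) (ρ : Measure X) [IsProbabilityMeasure ρ]
    (hρ : ∀ x, N * ρ {x} < 1) :
    ∃ α : ℝ, 0 < α ∧ ∃ P : Measure (Fin N → X), IsProbabilityMeasure P ∧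
      (∀ σ : Equiv.Perm (Fin N), P.map (fun x i => x (σ i)) = P) ∧
      (∀ i, P.map (fun x => x i) = ρ) ∧
      P.support ⊆ {x | Pairwise fun i j => α ≤ dist (x i) (x j)} ∧
      ∀ ω : ℝ≥0 → ℝ≥0, Monotone ω → (∀ r, 0 < r → 0 < ω r) →
        ∫⁻ x, ∑ p : Fin N × Fin N with p.1 < p.2,
          1 / (ω (nndist (x p.1) (x p.2)) : ℝ≥0∞) ∂P < ⊤ := by
  have : SecondCountableTopology X := UniformSpace.secondCountable_of_separable X
  have : IsFiniteMeasure ((N : ℝ≥0∞) • ρ) := ρ.smul_finite (ENNReal.natCast_ne_top N)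
  obtain ⟨α, hα, Q, _, hsep, hsum⟩ :=
    exists_measure_pairwise_le_dist (n := N) (μ := (N : ℝ≥0∞) • ρ) (by simp) (by simpa using hρ)
  have hclosed := isClosed_setOf_pairwise_le_dist (X := X) (I := Fin N) α
  have hsep' : ∀ᵐ x ∂symmetrization Q, Pairwise fun i j => α ≤ dist (x i) (x j) :=
    ae_symmetrization hclosed.measurableSet
      (fun σ x hx i j hij => hx (σ.injective.ne hij)) hsep
  have hperm := map_reindex_symmetrization Q
  refine ⟨α, hα, symmetrization Q, inferInstance, hperm, ?_,
    Measure.support_subset_of_isClosed hclosed hsep',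
    fun ω hmono hpos => lintegral_sum_one_div_lt_top hα hsep' hmono hpos⟩
  exact map_eval_eq_of_sum_map_eval_eq hperm
    (by rw [sum_map_eval_symmetrization, hsum, Fintype.card_fin, Nat.cast_smul_eq_nsmul])

theorem theorem1p3 (d N : ℕ) (hN : 1 ≤ N)
    (ρ : MeasureTheory.Measure (RepulsiveTransport.Pt d))
    [MeasureTheory.IsProbabilityMeasure ρ]
    (hρ : RepulsiveTransport.concentration ρ < 1 / (N : ℝ≥0∞)) :
    (∀ c : RepulsiveTransport.Config d N → ℝ≥0∞, RepulsiveTransport.IsRepulsiveCost c →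
      RepulsiveTransport.symmetricTransportCost c ρ < ⊤) ∧
    ∃ α : ℝ, 0 < α ∧ ∃ P : MeasureTheory.Measure (RepulsiveTransport.Config d N),
      RepulsiveTransport.IsSymmetricPlan ρ P ∧
      P.support ⊆ (RepulsiveTransport.nearDiagonal d N α)ᶜ ∧
      ∀ c : RepulsiveTransport.Config d N → ℝ≥0∞, RepulsiveTransport.IsRepulsiveCost c →
        ∫⁻ x, c x ∂P < ⊤ := by
  obtain ⟨α, hα, P, hprob, hperm, hmarg, hsupp, hcost⟩ := theorem1p3_general N ρ fun x =>
    ENNReal.mul_lt_of_lt_div' ((le_iSup (fun x => ρ {x}) x).trans_lt hρ)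
  have hP : RepulsiveTransport.IsSymmetricPlan ρ P := ⟨hprob, hperm, hmarg⟩
  have hfin (c : RepulsiveTransport.Config d N → ℝ≥0∞)
      (hc : RepulsiveTransport.IsRepulsiveCost c) : ∫⁻ x, c x ∂P < ⊤ := by
    obtain ⟨ω, hmono, hpos, rfl⟩ := hc.exists_monotone
    exact hcost ω hmono hpos
  exact ⟨fun c hc => (iInf₂_le P hP).trans_lt (hfin c hc), α, hα, P, hP,
    RepulsiveTransport.compl_nearDiagonal ▸ hsupp, hfin⟩
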